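/- Let $P=(p_1,\dots,p_N)$ be a sequence of $N$ points in $\mathbb{R}^d$, and let $E$ be a $k$-ary relation on $P$, that is, a set of $k$-tuples $(p_{i_1},\dots,p_{i_k})$ with $i_1<\cdots<i_k$. We say that $E$ is semi-algebraic of complexity at most $t$ if there are $t$ polynomials $f_1,\dots,f_t$ in $kd$ real variables, each of degree at most $t$, and a Boolean function $\Phi$ of $t$ variables such that for all $i_1<\cdots<i_k$ $$(p_{i_1},\dots,p_{i_k})\in E\iff \Phi\big(f_1(p_{i_1},\dots,p_{i_k})\ge 0,\ \dots,\ f_t(p_{i_1},\dots,p_{i_k})\ge 0\big)=1 .$$ Let $R_k^{d,t}(s,n)$ be the minimum integer $N$ such that for every sequence $P$ of $N$ points in $\mathbb{R}^d$ and every $k$-ary semi-algebraic relation $E$ on $P$ of complexity at most $t$, either $P$ has $s$ members such that every $k$-tuple induced by them is in $E$, or $P$ has $n$ members such that no $k$-tuple induced by them is in $E$. **Theorem.** For all integers $s\ge 4$ and $t\ge 0$ there is a constant $c>0$, depending only on $s$ and $t$, such that for every integer $n\ge 1$ the number $R_3^{1,t}(s,n)$ exists and satisfies $$R_3^{1,t}(s,n)\le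 2^{(\log_2 n)^c}.$$ -/

import Mathlib

/-- `A ⊆ ℝ^σ` is a semi-algebraic set cut out by a Boolean combination of the conditions `f l ≥ 0`,
for `t` real polynomials `f l` of (total) degree at most `t`.  (Fewer than `t` polynomials are
allowed too: pad with the zero polynomial and let `Φ` ignore it.) -/
def SemialgebraicSetLE {σ : Type} (t : ℕ) (A : Set (σ → ℝ)) : Prop :=
  ∃ (f : Fin t → MvPolynomial σ ℝ) (Φ : (Fin t → Prop) → Prop),
    (∀ l, (f l).totalDegree ≤ t) ∧
      A = {x | Φ (fun l => 0 ≤ MvPolynomial.eval x (f l))}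

/-- A `k`-ary relation `E` on a sequence `p` of `N` points of `ℝ^d` is a set of `k`-tuples of points
with increasing indices, that is, of strictly increasing maps `Fin k ↪o Fin N`.  It is
semi-algebraic of complexity at most `t` if it is induced by some semi-algebraic subset
`Estar` of `ℝ^{kd}` of complexity at most `t`. -/
def SemialgebraicRelLE {k d N : ℕ} (t : ℕ) (p : Fin N → Fin d → ℝ)
    (E : Set (Fin k ↪o Fin N)) : Prop :=
  ∃ Estar : Set (Fin k × Fin d → ℝ), SemialgebraicSetLE t Estar ∧
    ∀ i : Fin k ↪o Fin N, (fun x => p (i x.1) x.2) ∈ Estar ↔ i ∈ E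

/-- The set of all `N` such that every sequence of `N` points in `ℝ^d` with a `k`-ary semi-algebraic
relation `E` of complexity at most `t` has `s` members all of whose `k`-tuples belong to `E`, or
`n` members none of whose `k`-tuples belongs to `E`. -/
def semialgRamseySet (k d t s n : ℕ) : Set ℕ :=
  {N | ∀ (p : Fin N → Fin d → ℝ) (E : Set (Fin k ↪o Fin N)), SemialgebraicRelLE t p E →
    (∃ S : Finset (Fin N), S.card = s ∧ ∀ i : Fin k ↪o Fin N, (∀ j, i j ∈ S) → i ∈ E) ∨
    (∃ S : Finset (Fin N), S.card = n ∧ ∀ i : Fin k ↪o Fin N, (∀ j, i j ∈ S) → i ∉ E)}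

/-- The off-diagonal semi-algebraic Ramsey number: the least element of `semialgRamseySet`. -/
noncomputable def semialgRamsey (k d t s n : ℕ) : ℕ := sInf (semialgRamseySet k d t s n)

/-! Fix two of the three real variables: each of the `t` polynomials becomes a univariate polynomial
of degree at most `t`, so the relation changes truth value at no more than `t²` breakpoints. This is
the only use of semi-algebraicity.

Few breakpoints give canonical trees (`BinTree.exists_tripleCanonical`). Cut a set of reals into
many consecutive blocks and build a tree of depth `m` in each. The predicates with parameters in one
tree have few breakpoints altogether, so they are constant on most other blocks; hence some two
trees do not disturb each other, and they are joined under a new root. A tree of depth `m` costs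
only `2 ^ O(m³)` points, and in it the colour of a triple depends only on its two separating nodes.

In such a tree, Ramsey is cheap (`BinTree.exists_clique_or_independent`). A point on the other side
of the root induces a canonical graph on a subtree, whose depth splits as `a + b` between the two
colours. A large `a` gives a smaller clique to be extended by that point; otherwise both sides have
large `b`, and their independent sets unite, doubling the size. So depth `(2k+2)^s`, polynomial in
`k`, suffices for `n ≤ 2^k`, and the total is `2` to a power of `log₂ n`.

The order on indices need not be that of the reals, so an increasing, decreasing or constant
subsequence is extracted beforehand. -/

/-! ### Ramsey theory of canonically coloured trees -/

/-- Binary trees with labelled leaves. -/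
inductive BinTree (α : Type*) where
  | leaf (a : α) : BinTree α
  | node (l r : BinTree α) : BinTree α

namespace BinTree

variable {α : Type*}

/-- The leaves of a tree, from left to right. -/
def leaves : BinTree α → List α
  | leaf a => [a]
  | node l r => l.leaves ++ r.leaves

/-- Every branch of the tree has at least `n` nodes. -/
def HasDepth : ℕ → BinTree α → Prop
  | 0, _ => True
  | _ + 1, leaf _ => False
  | n + 1, node l r => HasDepth n l ∧ HasDepth n r

/-- The truth value of `G x y`, for a leaf `x` to the left of a leaf `y`, depends only on the node
at which `x` and `y` separate. -/
def Canonical (G : α → α → Prop) : BinTree α → Prop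
  | leaf _ => True
  | node l r => Canonical G l ∧ Canonical G r ∧
      ((∀ x ∈ l.leaves, ∀ y ∈ r.leaves, G x y) ∨ (∀ x ∈ l.leaves, ∀ y ∈ r.leaves, ¬ G x y))

/-- The truth value of `E x y z`, for leaves `x, y, z` from left to right, depends only on the two
nodes at which they separate. -/
def TripleCanonical (E : α → α → α → Prop) : BinTree α → Prop
  | leaf _ => True
  | node l r => TripleCanonical E l ∧ TripleCanonical E r ∧
      (∃ G, Canonical G l ∧
        ∀ x ∈ l.leaves, ∀ y ∈ l.leaves, ∀ z ∈ r.leaves, E x y z ↔ G x y) ∧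
      (∃ G, Canonical G r ∧
        ∀ x ∈ l.leaves, ∀ y ∈ r.leaves, ∀ z ∈ r.leaves, E x y z ↔ G y z)

/-- `Embeds S T`: the tree `S` arises from `T` by deleting leaves and suppressing the nodes that are
left with one child. -/
inductive Embeds : BinTree α → BinTree α → Prop
  | refl (T) : Embeds T T
  | left {S l r} : Embeds S l → Embeds S (node l r)
  | right {S l r} : Embeds S r → Embeds S (node l r)
  | node {l' r' l r} : Embeds l' l → Embeds r' r → Embeds (node l' r') (node l r)

theorem Embeds.sublist {S T : BinTree α} (h : Embeds S T) : S.leaves.Sublist T.leaves := by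
  induction h with
  | refl T => exact List.Sublist.refl _
  | left _ ih => exact ih.trans (List.sublist_append_left _ _)
  | right _ ih => exact ih.trans (List.sublist_append_right _ _)
  | node _ _ ih₁ ih₂ => exact ih₁.append ih₂

theorem Embeds.canonical {S T : BinTree α} (h : Embeds S T) {G : α → α → Prop}
    (hT : T.Canonical G) : S.Canonical G := by
  induction h with
  | refl T => exact hT
  | left _ ih => exact ih hT.1
  | right _ ih => exact ih hT.2.1
  | node h₁ h₂ ih₁ ih₂ =>
    refine ⟨ih₁ hT.1, ih₂ hT.2.1, hT.2.2.imp ?_ ?_⟩ <;>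
    exact fun H x hx y hy => H x (h₁.sublist.subset hx) y (h₂.sublist.subset hy)

theorem Embeds.tripleCanonical {S T : BinTree α} (h : Embeds S T) {E : α → α → α → Prop}
    (hT : T.TripleCanonical E) : S.TripleCanonical E := by
  induction h with
  | refl T => exact hT
  | left _ ih => exact ih hT.1
  | right _ ih => exact ih hT.2.1
  | node h₁ h₂ ih₁ ih₂ =>
    obtain ⟨hl, hr, ⟨G, hG, hG'⟩, ⟨H, hH, hH'⟩⟩ := hT
    refine ⟨ih₁ hl, ih₂ hr, ⟨G, h₁.canonical hG, fun x hx y hy z hz => ?_⟩,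
      ⟨H, h₂.canonical hH, fun x hx y hy z hz => ?_⟩⟩
    · exact hG' x (h₁.sublist.subset hx) y (h₁.sublist.subset hy) z (h₂.sublist.subset hz)
    · exact hH' x (h₁.sublist.subset hx) y (h₂.sublist.subset hy) z (h₂.sublist.subset hz)

theorem leaves_ne_nil : ∀ T : BinTree α, T.leaves ≠ []
  | leaf a => by simp [leaves]
  | node l r => by simp [leaves, leaves_ne_nil l]

theorem exists_mem_leaves (T : BinTree α) : ∃ x, x ∈ T.leaves :=
  List.exists_mem_of_ne_nil _ T.leaves_ne_nil

theorem HasDepth.mono : ∀ {n m : ℕ} {T : BinTree α}, HasDepth n T → m ≤ n → HasDepth m T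
  | _, 0, _, _, _ => trivial
  | 0, _ + 1, _, _, h => absurd h (by omega)
  | _ + 1, _ + 1, leaf _, h, _ => h.elim
  | _ + 1, _ + 1, node _ _, h, hm =>
    ⟨h.1.mono (Nat.le_of_succ_le_succ hm), h.2.mono (Nat.le_of_succ_le_succ hm)⟩

variable [LinearOrder α]

/-- A canonically coloured tree of depth `n` contains a tree of depth `a` in the first colour and a
tree of depth `n - a` in the second one, for some `a`. -/
theorem exists_monochromatic_embeds (G : α → α → Prop) :
    ∀ (n : ℕ) (T : BinTree α), HasDepth n T → T.Canonical G → T.leaves.Pairwise (· < ·) →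
      ∃ a b, a + b = n ∧
        (∃ S, Embeds S T ∧ HasDepth a S ∧ ∀ x ∈ S.leaves, ∀ y ∈ S.leaves, x < y → G x y) ∧
        (∃ S, Embeds S T ∧ HasDepth b S ∧ ∀ x ∈ S.leaves, ∀ y ∈ S.leaves, x < y → ¬ G x y) := by
  have single : ∀ T : BinTree α, ∃ a, Embeds (leaf a) T := by
    intro T
    induction T with
    | leaf a => exact ⟨a, .refl _⟩
    | node l r ih _ => exact ih.imp fun a h => h.left
  intro n
  induction n with
  | zero =>
    intro T _ _ _
    obtain ⟨a, ha⟩ := single T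
    exact ⟨0, 0, rfl, ⟨leaf a, ha, trivial, by simp [leaves]⟩, ⟨leaf a, ha, trivial, by simp [leaves]⟩⟩
  | succ n ih =>
    intro T hT hG hs
    cases T with
    | leaf a => exact hT.elim
    | node l r =>
      obtain ⟨hsl, hsr, hlr⟩ := List.pairwise_append.1 hs
      obtain ⟨a₁, b₁, h₁, ⟨S₁, e₁, d₁, g₁⟩, ⟨T₁, e₁', d₁', g₁'⟩⟩ := ih l hT.1 hG.1 hsl
      obtain ⟨a₂, b₂, h₂, ⟨S₂, e₂, d₂, g₂⟩, ⟨T₂, e₂', d₂', g₂'⟩⟩ := ih r hT.2 hG.2.1 hsr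
      have join : ∀ (H : α → α → Prop) (U V : BinTree α), Embeds U l → Embeds V r →
          (∀ x ∈ l.leaves, ∀ y ∈ r.leaves, H x y) →
          (∀ x ∈ U.leaves, ∀ y ∈ U.leaves, x < y → H x y) →
          (∀ x ∈ V.leaves, ∀ y ∈ V.leaves, x < y → H x y) →
          ∀ x ∈ (node U V).leaves, ∀ y ∈ (node U V).leaves, x < y → H x y := by
        intro H U V hU hV hH hUU hVV x hx y hy hxy
        rcases List.mem_append.1 hx with hx | hx <;> rcases List.mem_append.1 hy with hy | hy
        · exact hUU x hx y hy hxy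
        · exact hH x (hU.sublist.subset hx) y (hV.sublist.subset hy)
        · exact absurd (hlr y (hU.sublist.subset hy) x (hV.sublist.subset hx)) hxy.not_gt
        · exact hVV x hx y hy hxy
      -- The colour at the root gains one level on the smaller of the two depths in that colour.
      -- Since both pairs sum to `n`, the same side has the larger depth in the other colour, so the
      -- new sum is `n + 1`.
      rcases hG.2.2 with hc | hc
      · rcases le_total a₁ a₂ with h | h
        · exact ⟨a₁ + 1, b₁, by omega, ⟨node S₁ S₂, .node e₁ e₂, ⟨d₁, d₂.mono h⟩,
            join G _ _ e₁ e₂ hc g₁ g₂⟩, ⟨T₁, e₁'.left, d₁', g₁'⟩⟩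
        · exact ⟨a₂ + 1, b₂, by omega, ⟨node S₁ S₂, .node e₁ e₂, ⟨d₁.mono h, d₂⟩,
            join G _ _ e₁ e₂ hc g₁ g₂⟩, ⟨T₂, e₂'.right, d₂', g₂'⟩⟩
      · rcases le_total b₁ b₂ with h | h
        · exact ⟨a₁, b₁ + 1, by omega, ⟨S₁, e₁.left, d₁, g₁⟩, ⟨node T₁ T₂, .node e₁' e₂',
            ⟨d₁', d₂'.mono h⟩, join (fun x y => ¬ G x y) _ _ e₁' e₂' hc g₁' g₂'⟩⟩
        · exact ⟨a₂, b₂ + 1, by omega, ⟨S₂, e₂.right, d₂, g₂⟩, ⟨node T₁ T₂, .node e₁' e₂',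
            ⟨d₁'.mono h, d₂'⟩, join (fun x y => ¬ G x y) _ _ e₁' e₂' hc g₁' g₂'⟩⟩

/-- A canonically coloured tree of depth `(2k+2)^s` has `s` leaves all of whose triples belong to
`E`, or `2^k` leaves none of whose triples belongs to `E`. -/
theorem exists_clique_or_independent (E : α → α → α → Prop) :
    ∀ (s k : ℕ) (T : BinTree α), HasDepth ((2 * k + 2) ^ s) T → T.TripleCanonical E →
      T.leaves.Pairwise (· < ·) →
      (∃ S : Finset α, (∀ x ∈ S, x ∈ T.leaves) ∧ S.card = s ∧
        ∀ x ∈ S, ∀ y ∈ S, ∀ z ∈ S, x < y → y < z → E x y z) ∨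
      (∃ S : Finset α, (∀ x ∈ S, x ∈ T.leaves) ∧ S.card = 2 ^ k ∧
        ∀ x ∈ S, ∀ y ∈ S, ∀ z ∈ S, x < y → y < z → ¬ E x y z) := by
  intro s
  induction s with
  | zero => exact fun k T _ _ _ => .inl ⟨∅, by simp⟩
  | succ s ihs =>
    intro k
    induction k with
    | zero =>
      intro T _ _ _
      obtain ⟨a, ha⟩ := T.exists_mem_leaves
      refine .inr ⟨{a}, by simpa using ha, by simp, ?_⟩
      simp only [Finset.mem_singleton]
      rintro x rfl y rfl z rfl h
      exact absurd h (lt_irrefl _)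
    | succ k ihk =>
      intro T hT hE hs
      -- The `1` pays for the root. The other two terms are the depths needed to recurse on `s` and
      -- on `k`: if `a + b` is their sum, then `a` reaches the first or `b` the second.
      have hnum : (2 * (k + 1) + 2) ^ s + (2 * k + 2) ^ (s + 1) + 1 ≤
          (2 * (k + 1) + 2) ^ (s + 1) := by
        have h₁ : (2 * k + 2) ^ s ≤ (2 * (k + 1) + 2) ^ s := Nat.pow_le_pow_left (by omega) s
        have h₂ : 1 ≤ (2 * (k + 1) + 2) ^ s := Nat.one_le_pow _ _ (by omega)
        rw [pow_succ, pow_succ]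
        nlinarith
      replace hT := hT.mono hnum
      cases T with
      | leaf a => exact hT.elim
      | node l r =>
        obtain ⟨hl, hr⟩ := hT
        obtain ⟨hEl, hEr, ⟨G, hG, hG'⟩, ⟨H, hH, hH'⟩⟩ := hE
        obtain ⟨hsl, hsr, hlr⟩ := List.pairwise_append.1 hs
        have ml : ∀ x, x ∈ l.leaves → x ∈ (node l r).leaves :=
          fun x hx => List.mem_append_left _ hx
        have mr : ∀ x, x ∈ r.leaves → x ∈ (node l r).leaves :=
          fun x hx => List.mem_append_right _ hx
        obtain ⟨a₁, b₁, h₁, ⟨S₁, e₁, d₁, g₁⟩, ⟨T₁, e₁', d₁', g₁'⟩⟩ :=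
          exists_monochromatic_embeds G _ l hl hG hsl
        obtain ⟨a₂, b₂, h₂, ⟨S₂, e₂, d₂, g₂⟩, ⟨T₂, e₂', d₂', g₂'⟩⟩ :=
          exists_monochromatic_embeds H _ r hr hH hsr
        by_cases ha₁ : (2 * (k + 1) + 2) ^ s ≤ a₁
        · rcases ihs (k + 1) S₁ (d₁.mono ha₁) (e₁.tripleCanonical hEl) (hsl.sublist e₁.sublist)
            with ⟨S, hS, hc, hSE⟩ | ⟨S, hS, hc, hSE⟩
          · obtain ⟨w, hw⟩ := r.exists_mem_leaves
            have hSl : ∀ x ∈ S, x ∈ l.leaves := fun x hx => e₁.sublist.subset (hS x hx)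
            refine .inl ⟨insert w S, ?_, ?_, ?_⟩
            · intro x hx
              rcases Finset.mem_insert.1 hx with rfl | hx
              · exact mr _ hw
              · exact ml _ (hSl x hx)
            · rw [Finset.card_insert_of_notMem, hc]
              exact fun h => lt_irrefl _ (hlr w (hSl w h) w hw)
            · intro x hx y hy z hz hxy hyz
              have hlt : ∀ u ∈ S, u < w := fun u hu => hlr u (hSl u hu) w hw
              have hy' : y ∈ S := by
                rcases Finset.mem_insert.1 hy with rfl | hy
                · rcases Finset.mem_insert.1 hz with rfl | hz
                  · exact absurd hyz (lt_irrefl _)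
                  · exact absurd (hlt z hz) hyz.not_gt
                · exact hy
              have hx' : x ∈ S := by
                rcases Finset.mem_insert.1 hx with rfl | hx
                · exact absurd (hlt y hy') hxy.not_gt
                · exact hx
              rcases Finset.mem_insert.1 hz with rfl | hz
              · exact (hG' x (hSl x hx') y (hSl y hy') z hw).2
                  (g₁ x (hS x hx') y (hS y hy') hxy)
              · exact hSE x hx' y hy' z hz hxy hyz
          · exact .inr ⟨S, fun x hx => ml x (e₁.sublist.subset (hS x hx)), hc, hSE⟩
        by_cases ha₂ : (2 * (k + 1) + 2) ^ s ≤ a₂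
        · rcases ihs (k + 1) S₂ (d₂.mono ha₂) (e₂.tripleCanonical hEr) (hsr.sublist e₂.sublist)
            with ⟨S, hS, hc, hSE⟩ | ⟨S, hS, hc, hSE⟩
          · obtain ⟨w, hw⟩ := l.exists_mem_leaves
            have hSr : ∀ x ∈ S, x ∈ r.leaves := fun x hx => e₂.sublist.subset (hS x hx)
            refine .inl ⟨insert w S, ?_, ?_, ?_⟩
            · intro x hx
              rcases Finset.mem_insert.1 hx with rfl | hx
              · exact ml _ hw
              · exact mr _ (hSr x hx)
            · rw [Finset.card_insert_of_notMem, hc]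
              exact fun h => lt_irrefl _ (hlr w hw w (hSr w h))
            · intro x hx y hy z hz hxy hyz
              have hlt : ∀ u ∈ S, w < u := fun u hu => hlr w hw u (hSr u hu)
              have hy' : y ∈ S := by
                rcases Finset.mem_insert.1 hy with rfl | hy
                · rcases Finset.mem_insert.1 hx with rfl | hx
                  · exact absurd hxy (lt_irrefl _)
                  · exact absurd (hlt x hx) hxy.not_gt
                · exact hy
              have hz' : z ∈ S := by
                rcases Finset.mem_insert.1 hz with rfl | hz
                · exact absurd (hlt y hy') hyz.not_gt
                · exact hz
              rcases Finset.mem_insert.1 hx with rfl | hx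
              · exact (hH' x hw y (hSr y hy') z (hSr z hz')).2
                  (g₂ y (hS y hy') z (hS z hz') hyz)
              · exact hSE x hx y hy' z hz' hxy hyz
          · exact .inr ⟨S, fun x hx => mr x (e₂.sublist.subset (hS x hx)), hc, hSE⟩
        -- Both `a₁` and `a₂` are now small, so `b₁` and `b₂` are large. A mixed triple of the union
        -- has two points on one side, where `G` or `H` fails.
        rcases ihk T₁ (d₁'.mono (by omega)) (e₁'.tripleCanonical hEl) (hsl.sublist e₁'.sublist)
          with ⟨S, hS, hc, hSE⟩ | ⟨S, hS, hc, hSE⟩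
        · exact .inl ⟨S, fun x hx => ml x (e₁'.sublist.subset (hS x hx)), hc, hSE⟩
        rcases ihk T₂ (d₂'.mono (by omega)) (e₂'.tripleCanonical hEr) (hsr.sublist e₂'.sublist)
          with ⟨R, hR, hc', hRE⟩ | ⟨R, hR, hc', hRE⟩
        · exact .inl ⟨R, fun x hx => mr x (e₂'.sublist.subset (hR x hx)), hc', hRE⟩
        have hSl : ∀ x ∈ S, x ∈ l.leaves := fun x hx => e₁'.sublist.subset (hS x hx)
        have hRr : ∀ x ∈ R, x ∈ r.leaves := fun x hx => e₂'.sublist.subset (hR x hx)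
        have hlt : ∀ x ∈ S, ∀ y ∈ R, x < y := fun x hx y hy => hlr x (hSl x hx) y (hRr y hy)
        refine .inr ⟨S ∪ R, ?_, ?_, ?_⟩
        · intro x hx
          rcases Finset.mem_union.1 hx with hx | hx
          · exact ml x (hSl x hx)
          · exact mr x (hRr x hx)
        · rw [Finset.card_union_of_disjoint, hc, hc', pow_succ, mul_two]
          exact Finset.disjoint_left.2 fun x hx hx' => lt_irrefl _ (hlt x hx x hx')
        · intro x hx y hy z hz hxy hyz
          rcases Finset.mem_union.1 hx with hx | hx <;> rcases Finset.mem_union.1 hy with hy | hy <;>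
            rcases Finset.mem_union.1 hz with hz | hz
          · exact hSE x hx y hy z hz hxy hyz
          · rw [hG' x (hSl x hx) y (hSl y hy) z (hRr z hz)]
            exact g₁' x (hS x hx) y (hS y hy) hxy
          · exact absurd (hlt z hz y hy) hyz.not_gt
          · rw [hH' x (hSl x hx) y (hRr y hy) z (hRr z hz)]
            exact g₂' y (hR y hy) z (hR z hz) hyz
          · exact absurd (hlt y hy x hx) hxy.not_gt
          · exact absurd (hlt y hy x hx) hxy.not_gt
          · exact absurd (hlt z hz y hy) hyz.not_gt
          · exact hRE x hx y hy z hz hxy hyz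

end BinTree

/-! ### Breakpoints, blocks and the construction of canonical trees -/

/-- The truth value of `φ` changes only at the points of a set of at most `C` breakpoints. -/
def FewCuts {α : Type*} [LinearOrder α] (C : ℕ) (φ : α → Prop) : Prop :=
  ∃ R : Finset α, R.card ≤ C ∧
    ∀ a b, a ≤ b → (∀ r ∈ R, a ≤ r → ¬ r ≤ b) → (φ a ↔ φ b)

section Blocks

variable {α : Type*} [LinearOrder α]

open Classical in
/-- A predicate with at most `C` breakpoints is constant on all but at most `C` members of an
increasing sequence of sets. -/
theorem FewCuts.card_nonconstant_le {C b : ℕ} {φ : α → Prop} (hφ : FewCuts C φ)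
    {B : Fin b → Finset α} (hB : ∀ i j, i < j → ∀ x ∈ B i, ∀ y ∈ B j, x < y)
    {z : Fin b → α} (hz : ∀ j, z j ∈ B j) :
    (Finset.univ.filter fun j => ∃ w ∈ B j, ¬ (φ w ↔ φ (z j))).card ≤ C := by
  obtain ⟨R, hR, hRφ⟩ := hφ
  -- A block on which `φ` varies straddles a breakpoint; as the blocks are ordered, distinct blocks
  -- straddle distinct breakpoints.
  have key : ∀ j : Fin b, (∃ w ∈ B j, ¬ (φ w ↔ φ (z j))) →
      ∃ r ∈ R, ∃ u ∈ B j, ∃ v ∈ B j, u ≤ r ∧ r ≤ v := by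
    rintro j ⟨w, hw, hne⟩
    by_contra hno
    push Not at hno
    rcases le_total w (z j) with h | h
    · exact hne (hRφ _ _ h fun r hr h₁ => (hno r hr w hw _ (hz j) h₁).not_ge)
    · exact hne (hRφ _ _ h fun r hr h₁ => (hno r hr _ (hz j) w hw h₁).not_ge).symm
  rcases isEmpty_or_nonempty (Fin b) with _ | ⟨⟨j₀⟩⟩
  · simp
  have : Nonempty α := ⟨z j₀⟩
  choose! r hrR u hu v hv hur hrv using key
  refine (Finset.card_le_card_of_injOn r ?_ ?_).trans hR
  · intro j hj
    exact hrR j (by simpa using hj)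
  · intro i hi j hj hij
    replace hi : ∃ w ∈ B i, ¬ (φ w ↔ φ (z i)) := by simpa using hi
    replace hj : ∃ w ∈ B j, ¬ (φ w ↔ φ (z j)) := by simpa using hj
    rcases lt_trichotomy i j with h | h | h
    · have := hB i j h _ (hv i hi) _ (hu j hj)
      exact absurd (((hur j hj).trans_eq hij.symm).trans (hrv i hi)) this.not_ge
    · exact h
    · have := hB j i h _ (hv j hj) _ (hu i hi)
      exact absurd (((hur i hi).trans_eq hij).trans (hrv j hj)) this.not_ge

-- Union bound: each predicate of the list spoils at most `C` blocks.
open Classical in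
theorem card_exists_nonconstant_le {C b : ℕ} {B : Fin b → Finset α}
    (hB : ∀ i j, i < j → ∀ x ∈ B i, ∀ y ∈ B j, x < y) {z : Fin b → α} (hz : ∀ j, z j ∈ B j) :
    ∀ P : List (α → Prop), (∀ φ ∈ P, FewCuts C φ) →
      (Finset.univ.filter fun j => ∃ φ ∈ P, ∃ w ∈ B j, ¬ (φ w ↔ φ (z j))).card ≤ P.length * C
  | [], _ => by simp
  | φ :: P, hP => by
    have h₁ := (hP φ (by simp)).card_nonconstant_le hB hz
    have h₂ := card_exists_nonconstant_le hB hz P fun ψ hψ => hP ψ (by simp [hψ])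
    rw [List.length_cons, Nat.succ_mul, Nat.add_comm]
    refine le_trans (Finset.card_le_card ?_) ((Finset.card_union_le _ _).trans (add_le_add h₁ h₂))
    intro j hj
    simpa only [Finset.mem_filter, Finset.mem_union, Finset.mem_univ, true_and,
      List.exists_mem_cons_iff] using hj

/-- A digraph on more than `2q + 1` vertices with outdegrees at most `q` has two nonadjacent
vertices. -/
theorem exists_nonadjacent_of_card_le {b q : ℕ} (f : Fin b → Finset (Fin b))
    (hf : ∀ i, (f i).card ≤ q) (hb : 2 * q + 1 < b) : ∃ i j, i < j ∧ j ∉ f i ∧ i ∉ f j := by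
  by_contra! hno
  have hS : (Finset.univ.sigma f).card ≤ b * q := by
    rw [Finset.card_sigma]
    exact (Finset.sum_le_sum fun i _ => hf i).trans (by simp)
  -- Otherwise the arcs and their reversals, at most `2bq` pairs, cover all `b(b - 1)` ordered
  -- pairs.
  have hsub : (Finset.univ : Finset (Fin b)).offDiag ⊆
      (Finset.univ.sigma f).image (fun p => (p.1, p.2)) ∪
      (Finset.univ.sigma f).image (fun p => (p.2, p.1)) := by
    rintro ⟨i, j⟩ hij
    replace hij : i ≠ j := by simpa using hij
    have : j ∈ f i ∨ i ∈ f j := by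
      by_contra! h
      rcases lt_or_gt_of_ne hij with hlt | hlt
      · exact h.2 (hno i j hlt h.1)
      · exact h.1 (hno j i hlt h.2)
    rcases this with h | h
    · exact Finset.mem_union_left _ (Finset.mem_image.2 ⟨⟨i, j⟩, by simpa using h, rfl⟩)
    · exact Finset.mem_union_right _ (Finset.mem_image.2 ⟨⟨j, i⟩, by simpa using h, rfl⟩)
  have hcard := (Finset.card_le_card hsub).trans ((Finset.card_union_le _ _).trans
    (add_le_add Finset.card_image_le Finset.card_image_le))
  rw [Finset.offDiag_card, Finset.card_univ, Fintype.card_fin] at hcard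
  have : b * b ≤ b * (2 * q + 1) := by
    have h : b * b ≤ b * q + b * q + b := by omega
    calc b * b ≤ b * q + b * q + b := h
      _ = b * (2 * q + 1) := by ring
  exact absurd (Nat.le_of_mul_le_mul_left this (by omega)) (by omega)

/-- A set of size `b * n` contains `b` consecutive blocks of size `n`. -/
theorem Finset.exists_blocks (A : Finset α) {b n : ℕ} (h : b * n ≤ A.card) :
    ∃ B : Fin b → Finset α, (∀ i, (B i).card = n ∧ B i ⊆ A) ∧
      ∀ i j, i < j → ∀ x ∈ B i, ∀ y ∈ B j, x < y := by
  let e := A.orderEmbOfCardLe h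
  have hinj : ∀ i : Fin b, Function.Injective fun k : Fin n => e (finProdFinEquiv (i, k)) := by
    intro i k k' hk
    simpa using hk
  refine ⟨fun i => Finset.univ.image fun k : Fin n => e (finProdFinEquiv (i, k)), fun i => ⟨?_, ?_⟩, ?_⟩
  · rw [Finset.card_image_of_injective _ (hinj i), Finset.card_univ, Fintype.card_fin]
  · intro x hx
    obtain ⟨k, -, rfl⟩ := Finset.mem_image.1 hx
    exact A.orderEmbOfCardLe_mem h _
  · intro i j hij x hx y hy
    obtain ⟨k, -, rfl⟩ := Finset.mem_image.1 hx
    obtain ⟨k', -, rfl⟩ := Finset.mem_image.1 hy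
    refine e.strictMono ?_
    rw [Fin.lt_def, finProdFinEquiv_apply_val, finProdFinEquiv_apply_val]
    have h₁ : n * (i + 1) ≤ n * j := Nat.mul_le_mul_left n (Nat.succ_le_of_lt hij)
    have := k.2
    have h₂ : n * (i + 1 : ℕ) = n * i + n := by ring
    dsimp only
    omega

open Classical in
/-- A large set contains the leaves of a tree of depth `m` that is canonical for a given ternary
relation and for given binary relations, provided that fixing all variables but one in one of these
relations always leaves a predicate with few breakpoints. -/
theorem BinTree.exists_tripleCanonical {C M W : ℕ} (hW : 4 * C * 4 ^ M + 2 ≤ W)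
    (E : α → α → α → Prop) (hE₁ : ∀ y z, FewCuts C fun x => E x y z)
    (hE₂ : ∀ x z, FewCuts C fun y => E x y z) (hE₃ : ∀ x y, FewCuts C fun z => E x y z) :
    ∀ m ≤ M, ∀ L : List (α → α → Prop),
      (∀ G ∈ L, (∀ x, FewCuts C fun y => G x y) ∧ ∀ y, FewCuts C fun x => G x y) →
      ∀ A : Finset α, ((L.length + 1) * (3 * W) ^ m) ^ m ≤ A.card →
      ∃ T : BinTree α, HasDepth m T ∧ T.leaves.length = 2 ^ m ∧ T.leaves.Pairwise (· < ·) ∧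
        (∀ x ∈ T.leaves, x ∈ A) ∧ T.TripleCanonical E ∧ ∀ G ∈ L, T.Canonical G := by
  intro m
  induction m with
  | zero =>
    intro _ L _ A hA
    obtain ⟨a, ha⟩ := Finset.card_pos.1 (lt_of_lt_of_le (by simp) hA)
    exact ⟨leaf a, trivial, rfl, by simp [leaves], by simpa [leaves] using ha, trivial,
      fun _ _ => trivial⟩
  | succ m ih =>
    intro hm L hL A hA
    set K := L.length with hK
    set b := (K + 1) * W with hb
    -- Each level adds two binary relations per block to the list, so the length plus one grows by a
    -- factor of at most `3W`.
    have hKb : K + 2 * b + 1 ≤ (K + 1) * (3 * W) := by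
      have : (K + 1) * 2 ≤ (K + 1) * W := Nat.mul_le_mul_left _ (by omega)
      have h3 : (K + 1) * (3 * W) = 3 * ((K + 1) * W) := by ring
      omega
    have hsize : b * ((K + 2 * b + 1) * (3 * W) ^ m) ^ m ≤ A.card := by
      refine le_trans ?_ hA
      rw [pow_succ ((K + 1) * (3 * W) ^ (m + 1)), mul_comm]
      refine Nat.mul_le_mul (Nat.pow_le_pow_left ?_ m) ?_
      · calc (K + 2 * b + 1) * (3 * W) ^ m ≤ (K + 1) * (3 * W) * (3 * W) ^ m :=
              Nat.mul_le_mul_right _ hKb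
          _ = (K + 1) * (3 * W) ^ (m + 1) := by ring
      · refine Nat.mul_le_mul_left _ ?_
        calc W ≤ 3 * W := by omega
          _ ≤ (3 * W) ^ (m + 1) := Nat.le_self_pow (by omega) _
    obtain ⟨B, hBc, hB⟩ := A.exists_blocks hsize
    have hBne : ∀ i, (B i).Nonempty := by
      intro i
      rw [← Finset.card_pos, (hBc i).1]
      have : 0 < W := by omega
      positivity
    choose z hz using hBne
    -- Which two blocks will be joined is not yet known, so every tree is made canonical for the
    -- relations induced by all representatives `z j`.
    let L' : List (α → α → Prop) := L ++ ((List.ofFn fun j x y => E x y (z j)) ++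
      List.ofFn fun j x y => E (z j) x y)
    have hL' : ∀ G ∈ L', (∀ x, FewCuts C fun y => G x y) ∧ ∀ y, FewCuts C fun x => G x y := by
      intro G hG
      rcases List.mem_append.1 hG with hG | hG
      · exact hL G hG
      rcases List.mem_append.1 hG with hG | hG
      · obtain ⟨j, rfl⟩ := List.mem_ofFn.1 hG
        exact ⟨fun x => hE₂ x (z j), fun y => hE₁ y (z j)⟩
      · obtain ⟨j, rfl⟩ := List.mem_ofFn.1 hG
        exact ⟨fun x => hE₃ (z j) x, fun y => hE₂ (z j) y⟩
    have hlen : L'.length = K + 2 * b := by simp [L', hK]; ring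
    choose T hTd hTl hTs hTB hTE hTG using fun i => ih (by omega) L' hL' (B i)
      (by rw [hlen, (hBc i).1])
    let P : Fin b → List (α → Prop) := fun i =>
      ((T i).leaves ×ˢ (T i).leaves).map (fun p z => E p.1 p.2 z) ++
      (((T i).leaves ×ˢ (T i).leaves).map (fun p x => E x p.1 p.2) ++
      ((L ×ˢ (T i).leaves).map (fun p y => p.1 p.2 y) ++
      (L ×ˢ (T i).leaves).map (fun p x => p.1 x p.2)))
    have hP : ∀ i, ∀ φ ∈ P i, FewCuts C φ := by
      intro i φ hφ
      simp only [P, List.mem_append, List.mem_map] at hφ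
      rcases hφ with ⟨p, hp, rfl⟩ | ⟨p, hp, rfl⟩ | ⟨p, hp, rfl⟩ | ⟨p, hp, rfl⟩
      · exact hE₃ _ _
      · exact hE₁ _ _
      · exact (hL _ (List.pair_mem_product.1 hp).1).1 _
      · exact (hL _ (List.pair_mem_product.1 hp).1).2 _
    have hPl : ∀ i, (P i).length ≤ 2 * 4 ^ M * (K + 1) := by
      intro i
      have h₁ : (P i).length = 2 * (2 ^ m * 2 ^ m) + 2 * (K * 2 ^ m) := by
        simp only [P, List.length_append, List.length_map, List.length_product, hTl, ← hK]
        ring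
      have h₂ : 2 ^ m * 2 ^ m ≤ 4 ^ M := by
        rw [← mul_pow]
        exact Nat.pow_le_pow_right (by norm_num) (by omega)
      have h₃ : 2 ^ m ≤ 4 ^ M := le_trans (Nat.le_mul_of_pos_left _ (by positivity)) h₂
      have h₄ := Nat.mul_le_mul_left K h₃
      rw [h₁]
      nlinarith
    -- An arc from `i` to `j` means that a leaf or pair of leaves of `T i` gives a predicate not
    -- constant on `B j`. For nonadjacent blocks, any point of one may be replaced by its
    -- representative when seen from the other tree.
    obtain ⟨i, j, hij, hi, hj⟩ := exists_nonadjacent_of_card_le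
      (fun i => Finset.univ.filter fun j => ∃ φ ∈ P i, ∃ w ∈ B j, ¬ (φ w ↔ φ (z j)))
      (fun i => (card_exists_nonconstant_le hB hz (P i) (hP i)).trans
        (Nat.mul_le_mul_right C (hPl i))) (by
          have : (K + 1) * (4 * C * 4 ^ M + 2) ≤ b := Nat.mul_le_mul_left _ hW
          have h₂ : (K + 1) * (4 * C * 4 ^ M + 2) =
            2 * (2 * 4 ^ M * (K + 1) * C) + 2 * K + 2 := by ring
          omega)
    simp only [Finset.mem_filter, Finset.mem_univ, true_and, not_exists, not_and, not_not] at hi hj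
    have a₁ : ∀ x ∈ (T i).leaves, ∀ y ∈ (T i).leaves, ∀ w ∈ B j, E x y w ↔ E x y (z j) := by
      intro x hx y hy w hw
      refine hi (fun z => E x y z) ?_ w hw
      exact List.mem_append_left _ (List.mem_map.2 ⟨(x, y), List.pair_mem_product.2 ⟨hx, hy⟩, rfl⟩)
    have a₂ : ∀ x ∈ (T j).leaves, ∀ y ∈ (T j).leaves, ∀ w ∈ B i, E w x y ↔ E (z i) x y := by
      intro x hx y hy w hw
      refine hj (fun z => E z x y) ?_ w hw
      exact List.mem_append_right _ (List.mem_append_left _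
        (List.mem_map.2 ⟨(x, y), List.pair_mem_product.2 ⟨hx, hy⟩, rfl⟩))
    have a₃ : ∀ G ∈ L, ∀ x ∈ (T i).leaves, ∀ w ∈ B j, G x w ↔ G x (z j) := by
      intro G hG x hx w hw
      refine hi (fun y => G x y) ?_ w hw
      exact List.mem_append_right _ (List.mem_append_right _ (List.mem_append_left _
        (List.mem_map.2 ⟨(G, x), List.pair_mem_product.2 ⟨hG, hx⟩, rfl⟩)))
    have a₄ : ∀ G ∈ L, ∀ y ∈ (T j).leaves, ∀ w ∈ B i, G w y ↔ G (z i) y := by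
      intro G hG y hy w hw
      refine hj (fun x => G x y) ?_ w hw
      exact List.mem_append_right _ (List.mem_append_right _ (List.mem_append_right _
        (List.mem_map.2 ⟨(G, y), List.pair_mem_product.2 ⟨hG, hy⟩, rfl⟩)))
    refine ⟨node (T i) (T j), ⟨hTd i, hTd j⟩, ?_, ?_, ?_, ?_, ?_⟩
    · simp only [leaves, List.length_append, hTl, pow_succ, mul_two]
    · exact List.pairwise_append.2 ⟨hTs i, hTs j, fun x hx y hy =>
        hB i j hij x (hTB i x hx) y (hTB j y hy)⟩
    · intro x hx
      rcases List.mem_append.1 hx with hx | hx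
      · exact (hBc i).2 (hTB i x hx)
      · exact (hBc j).2 (hTB j x hx)
    · refine ⟨hTE i, hTE j, ⟨fun x y => E x y (z j), hTG i _ ?_, ?_⟩,
        ⟨fun x y => E (z i) x y, hTG j _ ?_, ?_⟩⟩
      · exact List.mem_append_right _ (List.mem_append_left _ (List.mem_ofFn.2 ⟨j, rfl⟩))
      · exact fun x hx y hy w hw => a₁ x hx y hy w (hTB j w hw)
      · exact List.mem_append_right _ (List.mem_append_right _ (List.mem_ofFn.2 ⟨i, rfl⟩))
      · exact fun w hw x hx y hy => a₂ x hx y hy w (hTB i w hw)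
    · intro G hG
      refine ⟨hTG i G (List.mem_append_left _ hG), hTG j G (List.mem_append_left _ hG), ?_⟩
      obtain ⟨y₀, hy₀⟩ := (T j).exists_mem_leaves
      have hc : ∀ x ∈ (T i).leaves, ∀ y ∈ (T j).leaves, G x y ↔ G (z i) y₀ := by
        intro x hx y hy
        rw [a₃ G hG x hx y (hTB j y hy), ← a₃ G hG x hx y₀ (hTB j y₀ hy₀),
          a₄ G hG y₀ hy₀ x (hTB i x hx)]
      by_cases h : G (z i) y₀
      · exact .inl fun x hx y hy => (hc x hx y hy).2 h
      · exact .inr fun x hx y hy => fun h' => h ((hc x hx y hy).1 h')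

/-- A large set on which a ternary relation has few breakpoints in each variable contains a clique
of size `s` or an independent set of size `2^k`. -/
theorem exists_clique_or_independent_of_fewCuts {C s k m : ℕ} (hm : m = (2 * k + 2) ^ s)
    (E : α → α → α → Prop) (hE₁ : ∀ y z, FewCuts C fun x => E x y z)
    (hE₂ : ∀ x z, FewCuts C fun y => E x y z) (hE₃ : ∀ x y, FewCuts C fun z => E x y z)
    (A : Finset α) (hA : (3 * (4 * C * 4 ^ m + 2)) ^ (m * m) ≤ A.card) :
    (∃ S ⊆ A, S.card = s ∧ ∀ x ∈ S, ∀ y ∈ S, ∀ z ∈ S, x < y → y < z → E x y z) ∨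
    (∃ S ⊆ A, S.card = 2 ^ k ∧ ∀ x ∈ S, ∀ y ∈ S, ∀ z ∈ S, x < y → y < z → ¬ E x y z) := by
  obtain ⟨T, hTd, -, hTs, hTA, hTE, -⟩ := BinTree.exists_tripleCanonical (le_refl _) E hE₁ hE₂ hE₃
    m le_rfl [] (by simp) A (by simpa [← pow_mul] using hA)
  subst hm
  refine (BinTree.exists_clique_or_independent E s k T hTd hTE hTs).imp ?_ ?_ <;>
  exact fun ⟨S, hS, h⟩ => ⟨S, fun x hx => hTA x (hS x hx), h⟩

end Blocks

/-! ### Roots of polynomials as breakpoints -/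

/-- On a line on which the coordinates are polynomials of degree at most one, membership in a
semi-algebraic set of complexity at most `t` has at most `t²` breakpoints. -/
theorem SemialgebraicSetLE.fewCuts {σ : Type} {t : ℕ} {A : Set (σ → ℝ)}
    (hA : SemialgebraicSetLE t A) (v : σ → Polynomial ℝ) (hv : ∀ q, (v q).natDegree ≤ 1) :
    FewCuts (t * t) fun r => (fun q => (v q).eval r) ∈ A := by
  classical
  obtain ⟨f, Φ, hf, rfl⟩ := hA
  have heval : ∀ l r, MvPolynomial.eval (fun q => (v q).eval r) (f l) =
      (MvPolynomial.aeval v (f l)).eval r := by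
    intro l r
    rw [← Polynomial.coe_evalRingHom, MvPolynomial.aeval_def, MvPolynomial.hom_eval₂,
      MvPolynomial.eval, MvPolynomial.eval₂Hom]
    exact congrArg (fun g => MvPolynomial.eval₂ g (fun q => (v q).eval r) (f l))
      (RingHom.ext fun x => by simp)
  refine ⟨Finset.univ.biUnion fun l => (MvPolynomial.aeval v (f l)).roots.toFinset, ?_, ?_⟩
  · refine Finset.card_biUnion_le.trans ((Finset.sum_le_sum fun l _ => ?_).trans (b := ∑ l : Fin t, t)
      (by simp))
    calc _ ≤ Multiset.card (MvPolynomial.aeval v (f l)).roots := Multiset.toFinset_card_le _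
      _ ≤ (MvPolynomial.aeval v (f l)).natDegree := Polynomial.card_roots' _
      _ ≤ t * 1 := MvPolynomial.aeval_natDegree_le _ (hf l) v hv
      _ = t := mul_one t
  · intro a b hab hroot
    have key : ∀ l, (0 ≤ (MvPolynomial.aeval v (f l)).eval a) ↔
        0 ≤ (MvPolynomial.aeval v (f l)).eval b := by
      intro l
      set g := MvPolynomial.aeval v (f l) with hg
      -- The zero polynomial has an empty `roots` multiset, but its sign is constant anyway.
      by_cases h0 : g = 0
      · simp [h0]
      have hno : ∀ r ∈ Set.Icc a b, g.eval r ≠ 0 := by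
        intro r hr h
        refine hroot r ?_ hr.1 hr.2
        exact Finset.mem_biUnion.2 ⟨l, Finset.mem_univ _,
          Multiset.mem_toFinset.2 ((Polynomial.mem_roots h0).2 h)⟩
      constructor
      · intro h
        by_contra! h'
        obtain ⟨r, hr, hr0⟩ := intermediate_value_Icc' hab g.continuous.continuousOn ⟨h'.le, h⟩
        exact hno r hr hr0
      · intro h
        by_contra! h'
        obtain ⟨r, hr, hr0⟩ := intermediate_value_Icc hab g.continuous.continuousOn ⟨h'.le, h⟩
        exact hno r hr hr0
    simp only [Set.mem_ofPred_eq, heval, key]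

/-! ### Chains and antichains -/

/-- A quantitative chain-antichain alternative for a transitive relation that refines the order. -/
theorem Finset.exists_chain_or_antichain {ι : Type*} [LinearOrder ι] {r : ι → ι → Prop}
    (htrans : ∀ i j k, r i j → r j k → r i k) (hlt : ∀ i j, r i j → i < j) (b : ℕ) :
    ∀ (a : ℕ) (S : Finset ι), a * b < S.card →
      (∃ T ⊆ S, T.card = a + 1 ∧ ∀ i ∈ T, ∀ j ∈ T, i < j → r i j) ∨
      (∃ T ⊆ S, T.card = b + 1 ∧ ∀ i ∈ T, ∀ j ∈ T, i < j → ¬ r i j) := by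
  classical
  intro a
  induction a with
  | zero =>
    intro S hS
    obtain ⟨i, hi⟩ := Finset.card_pos.1 (lt_of_le_of_lt (Nat.zero_le _) hS)
    refine .inl ⟨{i}, by simpa using hi, by simp, ?_⟩
    simp only [Finset.mem_singleton]
    rintro i rfl j rfl h
    exact absurd h (lt_irrefl _)
  | succ a ih =>
    intro S hS
    -- The minimal elements form an antichain. If they are few, a chain among the rest extends
    -- downwards by one element.
    set M := S.filter fun i => ∀ j ∈ S, ¬ r j i with hM
    by_cases hb : b + 1 ≤ M.card
    · obtain ⟨T, hTM, hT⟩ := Finset.exists_subset_card_eq hb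
      exact .inr ⟨T, hTM.trans (Finset.filter_subset _ _), hT, fun i hi j hj _ =>
        (Finset.mem_filter.1 (hTM hj)).2 i (Finset.mem_filter.1 (hTM hi)).1⟩
    · have hcard : a * b < (S \ M).card := by
        have := Finset.card_sdiff_add_card_eq_card (Finset.filter_subset _ S : M ⊆ S)
        rw [Nat.succ_mul] at hS
        rw [← hM] at this
        omega
      rcases ih _ hcard with ⟨T, hTS, hT, hTr⟩ | ⟨T, hTS, hT⟩
      · have hne : T.Nonempty := Finset.card_pos.1 (by omega)
        have hmin := Finset.mem_sdiff.1 (hTS (T.min'_mem hne))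
        obtain ⟨j, hj, hjr⟩ : ∃ j ∈ S, r j (T.min' hne) := by
          by_contra! h
          exact hmin.2 (Finset.mem_filter.2 ⟨hmin.1, h⟩)
        have hjT : ∀ i ∈ T, r j i := by
          intro i hi
          rcases (T.min'_le i hi).eq_or_lt with h | h
          · exact h ▸ hjr
          · exact htrans _ _ _ hjr (hTr _ (T.min'_mem hne) i hi h)
        refine .inl ⟨insert j T, ?_, ?_, ?_⟩
        · exact Finset.insert_subset hj (hTS.trans Finset.sdiff_subset)
        · rw [Finset.card_insert_of_notMem, hT]
          exact fun h => lt_irrefl _ (hlt _ _ (hjT j h))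
        · intro i hi k hk hik
          rcases Finset.mem_insert.1 hi with rfl | hi' <;>
            rcases Finset.mem_insert.1 hk with rfl | hk'
          · exact absurd hik (lt_irrefl _)
          · exact hjT k hk'
          · exact absurd (hlt _ _ (hjT i hi')) hik.not_gt
          · exact hTr i hi' k hk' hik
      · exact .inr ⟨T, hTS.trans Finset.sdiff_subset, hT⟩

/-! ### From sets of reals to sequences of points -/

section Ramsey

/-- The size of a set of reals that guarantees a canonical tree of depth `(2k+2)^s`. -/
def canonicalTreeBound (s t k : ℕ) : ℕ :=
  (3 * (4 * (t * t) * 4 ^ ((2 * k + 2) ^ s) + 2)) ^ ((2 * k + 2) ^ s * (2 * k + 2) ^ s)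

/-- The Ramsey statement for a sequence of reals that is strictly monotone up to the sign `ε`. -/
theorem exists_clique_or_independent_of_strictMonoOn {s t k N : ℕ} {p : Fin N → Fin 1 → ℝ}
    {E : Set (Fin 3 ↪o Fin N)} (hE : SemialgebraicRelLE t p E) (ε : ℝ) (hε : ε * ε = 1)
    (T : Finset (Fin N)) (hT : ∀ i ∈ T, ∀ j ∈ T, i < j → ε * p i 0 < ε * p j 0)
    (hcard : canonicalTreeBound s t k ≤ T.card) :
    (∃ S : Finset (Fin N), S.card = s ∧ ∀ i : Fin 3 ↪o Fin N, (∀ j, i j ∈ S) → i ∈ E) ∨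
    (∃ S : Finset (Fin N), S.card = 2 ^ k ∧ ∀ i : Fin 3 ↪o Fin N, (∀ j, i j ∈ S) → i ∉ E) := by
  classical
  obtain ⟨A, hA, hAE⟩ := hE
  let f : Fin N → ℝ := fun i => ε * p i 0
  -- The tree argument runs on the increasing values `ε * p i 0`; multiplying by `ε` again recovers
  -- the original points.
  let F : ℝ → ℝ → ℝ → Prop := fun x y z =>
    (fun q : Fin 3 × Fin 1 => ![ε * x, ε * y, ε * z] q.1) ∈ A
  have hFE : ∀ i : Fin 3 ↪o Fin N, F (f (i 0)) (f (i 1)) (f (i 2)) ↔ i ∈ E := by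
    intro i
    rw [← hAE i]
    have : (fun q : Fin 3 × Fin 1 => ![ε * f (i 0), ε * f (i 1), ε * f (i 2)] q.1) =
        fun x => p (i x.1) x.2 := by
      funext ⟨a, b⟩
      obtain rfl : b = 0 := Subsingleton.elim _ _
      fin_cases a <;> simp [f, ← mul_assoc, hε]
    simp only [F, this]
  have hinj : Set.InjOn f T := by
    intro i hi j hj hij
    rcases lt_trichotomy i j with h | h | h
    · exact absurd hij (hT i hi j hj h).ne
    · exact h
    · exact absurd hij (hT j hj i hi h).ne'
  have hX : (Polynomial.C ε * Polynomial.X : Polynomial ℝ).natDegree ≤ 1 :=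
    (Polynomial.natDegree_C_mul_le _ _).trans Polynomial.natDegree_X_le
  have cut : ∀ v : Fin 3 → Polynomial ℝ, (∀ a, (v a).natDegree ≤ 1) →
      FewCuts (t * t) fun r => (fun q : Fin 3 × Fin 1 => (v q.1).eval r) ∈ A :=
    fun v hv => hA.fewCuts (fun q => v q.1) fun q => hv q.1
  have hF₁ : ∀ y z, FewCuts (t * t) fun x => F x y z := by
    intro y z
    convert cut ![.C ε * .X, .C (ε * y), .C (ε * z)]
      (by intro a; fin_cases a <;> first | exact hX | exact (Polynomial.natDegree_C _).le.trans zero_le_one) using 2 with r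
    simp only [F]
    congr! 2 with q
    obtain ⟨a, b⟩ := q
    fin_cases a <;> simp
  have hF₂ : ∀ x z, FewCuts (t * t) fun y => F x y z := by
    intro x z
    convert cut ![.C (ε * x), .C ε * .X, .C (ε * z)]
      (by intro a; fin_cases a <;> first | exact hX | exact (Polynomial.natDegree_C _).le.trans zero_le_one) using 2 with r
    simp only [F]
    congr! 2 with q
    obtain ⟨a, b⟩ := q
    fin_cases a <;> simp
  have hF₃ : ∀ x y, FewCuts (t * t) fun z => F x y z := by
    intro x y
    convert cut ![.C (ε * x), .C (ε * y), .C ε * .X]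
      (by intro a; fin_cases a <;> first | exact hX | exact (Polynomial.natDegree_C _).le.trans zero_le_one) using 2 with r
    simp only [F]
    congr! 2 with q
    obtain ⟨a, b⟩ := q
    fin_cases a <;> simp
  have pull : ∀ S ⊆ T.image f, (T.filter fun i => f i ∈ S).card = S.card := by
    intro S hS
    rw [← Finset.card_image_of_injOn (f := f) (hinj.mono (Finset.coe_subset.2 (Finset.filter_subset _ _)))]
    congr 1
    ext x
    simp only [Finset.mem_image, Finset.mem_filter]
    constructor
    · rintro ⟨i, ⟨-, hi⟩, rfl⟩
      exact hi
    · intro hx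
      obtain ⟨i, hi, rfl⟩ := Finset.mem_image.1 (hS hx)
      exact ⟨i, ⟨hi, hx⟩, rfl⟩
  have lift : ∀ (S : Finset ℝ) (i : Fin 3 ↪o Fin N), (∀ j, i j ∈ T.filter fun i => f i ∈ S) →
      (∀ j, f (i j) ∈ S) ∧ f (i 0) < f (i 1) ∧ f (i 1) < f (i 2) := by
    intro S i hi
    simp only [Finset.mem_filter] at hi
    exact ⟨fun j => (hi j).2, hT _ (hi 0).1 _ (hi 1).1 (i.strictMono (by decide)),
      hT _ (hi 1).1 _ (hi 2).1 (i.strictMono (by decide))⟩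
  rcases exists_clique_or_independent_of_fewCuts (s := s) (k := k) rfl F hF₁ hF₂ hF₃ (T.image f)
    (by rwa [Finset.card_image_of_injOn hinj]) with ⟨S, hST, hS, h⟩ | ⟨S, hST, hS, h⟩
  · refine .inl ⟨_, (pull S hST).trans hS, fun i hi => (hFE i).1 ?_⟩
    obtain ⟨h₁, h₂, h₃⟩ := lift S i hi
    exact h _ (h₁ 0) _ (h₁ 1) _ (h₁ 2) h₂ h₃
  · refine .inr ⟨_, (pull S hST).trans hS, fun i hi hiE => ?_⟩
    obtain ⟨h₁, h₂, h₃⟩ := lift S i hi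
    exact h _ (h₁ 0) _ (h₁ 1) _ (h₁ 2) h₂ h₃ ((hFE i).2 hiE)

/-- Two applications of the chain-antichain alternative give an increasing or decreasing subsequence
long enough for the tree bound, or more than `s + n` equal points. In the last case all triples have
the same status. -/
theorem mem_semialgRamseySet_three_one {s t n k N : ℕ} (hn : n ≤ 2 ^ k)
    (hN : canonicalTreeBound s t k * (canonicalTreeBound s t k * (s + n)) < N) :
    N ∈ semialgRamseySet 3 1 t s n := by
  intro p E hE
  set M := canonicalTreeBound s t k
  have finish : ∀ (ε : ℝ), ε * ε = 1 → ∀ T : Finset (Fin N),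
      (∀ i ∈ T, ∀ j ∈ T, i < j → ε * p i 0 < ε * p j 0) → M ≤ T.card →
      (∃ S : Finset (Fin N), S.card = s ∧ ∀ i : Fin 3 ↪o Fin N, (∀ j, i j ∈ S) → i ∈ E) ∨
      (∃ S : Finset (Fin N), S.card = n ∧ ∀ i : Fin 3 ↪o Fin N, (∀ j, i j ∈ S) → i ∉ E) := by
    intro ε hε T hT hcard
    refine (exists_clique_or_independent_of_strictMonoOn hE ε hε T hT hcard).imp_right ?_
    rintro ⟨S, hS, h⟩
    obtain ⟨S', hS', hc⟩ := Finset.exists_subset_card_eq (hn.trans hS.ge)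
    exact ⟨S', hc, fun i hi => h i fun j => hS' (hi j)⟩
  rcases Finset.exists_chain_or_antichain (r := fun i j : Fin N => i < j ∧ p i 0 < p j 0)
    (fun i j k h₁ h₂ => ⟨h₁.1.trans h₂.1, h₁.2.trans h₂.2⟩) (fun i j h => h.1) (M * (s + n)) M
    Finset.univ (by simpa using hN) with ⟨T, -, hT, h⟩ | ⟨T, -, hT, h⟩
  · exact finish 1 (by norm_num) T (fun i hi j hj hij => by simpa using (h i hi j hj hij).2)
      (by omega)
  rcases Finset.exists_chain_or_antichain (r := fun i j : Fin N => i < j ∧ p j 0 < p i 0)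
    (fun i j k h₁ h₂ => ⟨h₁.1.trans h₂.1, h₂.2.trans h₁.2⟩) (fun i j h => h.1) (s + n) M
    T (by omega) with ⟨U, -, hU, h'⟩ | ⟨U, hUT, hU, h'⟩
  · exact finish (-1) (by norm_num) U (fun i hi j hj hij => by simpa using (h' i hi j hj hij).2)
      (by omega)
  have hconst : ∀ i ∈ U, ∀ j ∈ U, p i 0 = p j 0 := by
    have : ∀ i ∈ U, ∀ j ∈ U, i < j → p i 0 = p j 0 := fun i hi j hj hij =>
      le_antisymm (not_lt.1 fun hc => h' i hi j hj hij ⟨hij, hc⟩)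
        (not_lt.1 fun hc => h i (hUT hi) j (hUT hj) hij ⟨hij, hc⟩)
    intro i hi j hj
    rcases lt_trichotomy i j with hij | rfl | hij
    · exact this i hi j hj hij
    · rfl
    · exact (this j hj i hi hij).symm
  obtain ⟨u, hu⟩ : U.Nonempty := Finset.card_pos.1 (by omega)
  obtain ⟨A, -, hAE⟩ := hE
  have hmem : ∀ i : Fin 3 ↪o Fin N, (∀ j, i j ∈ U) → (i ∈ E ↔ (fun _ => p u 0) ∈ A) := by
    intro i hi
    rw [← hAE i]
    have : (fun x : Fin 3 × Fin 1 => p (i x.1) x.2) = fun _ => p u 0 := by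
      funext ⟨a, b⟩
      obtain rfl : b = 0 := Subsingleton.elim _ _
      exact hconst _ (hi a) u hu
    rw [this]
  by_cases hA : (fun _ => p u 0) ∈ A
  · obtain ⟨S, hS, hc⟩ := Finset.exists_subset_card_eq (show s ≤ U.card by omega)
    exact .inl ⟨S, hc, fun i hi => (hmem i fun j => hS (hi j)).2 hA⟩
  · obtain ⟨S, hS, hc⟩ := Finset.exists_subset_card_eq (show n ≤ U.card by omega)
    exact .inr ⟨S, hc, fun i hi hiE => hA ((hmem i fun j => hS (hi j)).1 hiE)⟩

end Ramsey

/-! ### Quasi-polynomial bounds -/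

section Numerics

/-- `f` is bounded by a power of its argument, for arguments at least two. -/
def PolyBounded (f : ℕ → ℕ) : Prop := ∃ c, ∀ k, 2 ≤ k → f k ≤ k ^ c

theorem PolyBounded.const (a : ℕ) : PolyBounded fun _ => a :=
  ⟨a, fun _ hk => Nat.lt_two_pow_self.le.trans (Nat.pow_le_pow_left hk a)⟩

theorem PolyBounded.id : PolyBounded fun k => k := ⟨1, fun k _ => by simp⟩

theorem PolyBounded.mul {f g : ℕ → ℕ} (hf : PolyBounded f) (hg : PolyBounded g) :
    PolyBounded fun k => f k * g k := by
  obtain ⟨a, ha⟩ := hf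
  obtain ⟨b, hb⟩ := hg
  exact ⟨a + b, fun k hk => (Nat.mul_le_mul (ha k hk) (hb k hk)).trans_eq (pow_add k a b).symm⟩

theorem PolyBounded.pow {f : ℕ → ℕ} (hf : PolyBounded f) (n : ℕ) :
    PolyBounded fun k => f k ^ n := by
  obtain ⟨a, ha⟩ := hf
  exact ⟨a * n, fun k hk => (Nat.pow_le_pow_left (ha k hk) n).trans_eq (pow_mul k a n).symm⟩

theorem PolyBounded.add {f g : ℕ → ℕ} (hf : PolyBounded f) (hg : PolyBounded g) :
    PolyBounded fun k => f k + g k := by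
  obtain ⟨a, ha⟩ := hf
  obtain ⟨b, hb⟩ := hg
  refine ⟨max a b + 1, fun k hk => ?_⟩
  have h₁ := (ha k hk).trans (Nat.pow_le_pow_right (by omega) (le_max_left a b))
  have h₂ := (hb k hk).trans (Nat.pow_le_pow_right (by omega) (le_max_right a b))
  have h₃ := Nat.mul_le_mul_left (k ^ max a b) hk
  calc f k + g k ≤ k ^ max a b * 2 := by omega
    _ ≤ k ^ (max a b + 1) := h₃

theorem canonicalTreeBound_le (s t k : ℕ) :
    canonicalTreeBound s t k ≤
      2 ^ ((t * t + 2 * (2 * k + 2) ^ s + 4) * ((2 * k + 2) ^ s * (2 * k + 2) ^ s)) := by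
  rw [canonicalTreeBound, pow_mul 2]
  refine Nat.pow_le_pow_left ?_ _
  generalize (2 * k + 2) ^ s = m
  have h₁ : t * t + 1 ≤ 2 ^ (t * t) := Nat.lt_two_pow_self
  have h₂ : 1 ≤ 4 ^ m := Nat.one_le_pow _ _ (by norm_num)
  have h₃ : 2 ^ (t * t + 2 * m + 4) = 16 * 2 ^ (t * t) * 4 ^ m := by
    rw [pow_add, pow_add, pow_mul 2 2 m]
    norm_num
    ac_rfl
  rw [h₃]
  calc 3 * (4 * (t * t) * 4 ^ m + 2) ≤ 16 * (t * t + 1) * 4 ^ m := by nlinarith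
    _ ≤ 16 * 2 ^ (t * t) * 4 ^ m := by gcongr

/-- Quasi-polynomially many points suffice. -/
theorem exists_ramsey_bound (s t : ℕ) : ∃ c, ∀ k n, 2 ≤ k → n ≤ 2 ^ k →
    ∃ N ∈ semialgRamseySet 3 1 t s n, N ≤ 2 ^ k ^ c := by
  have hm : PolyBounded fun k => (2 * k + 2) ^ s :=
    (((PolyBounded.const 2).mul .id).add (.const 2)).pow s
  have hX : PolyBounded fun k => (t * t + 2 * (2 * k + 2) ^ s + 4) *
      ((2 * k + 2) ^ s * (2 * k + 2) ^ s) :=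
    ((((PolyBounded.const (t * t)).add ((PolyBounded.const 2).mul hm)).add (.const 4)).mul
      (hm.mul hm))
  obtain ⟨c, hc⟩ := (((hX.add (hX.add ((PolyBounded.const s).add .id))).add (.const 2)))
  refine ⟨c, fun k n hk hn => ⟨_, mem_semialgRamseySet_three_one hn (Nat.lt_succ_self _), ?_⟩⟩
  refine le_trans ?_ (Nat.pow_le_pow_right (by norm_num) (hc k hk))
  have hM := canonicalTreeBound_le s t k
  set X := (t * t + 2 * (2 * k + 2) ^ s + 4) * ((2 * k + 2) ^ s * (2 * k + 2) ^ s)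
  have hsn : s + n ≤ 2 ^ (s + k + 1) := by
    have h₁ : s ≤ 2 ^ (s + k) :=
      Nat.lt_two_pow_self.le.trans (Nat.pow_le_pow_right (by norm_num) (Nat.le_add_right s k))
    have h₂ : n ≤ 2 ^ (s + k) :=
      hn.trans (Nat.pow_le_pow_right (by norm_num) (Nat.le_add_left k s))
    rw [pow_succ]
    omega
  have h := Nat.mul_le_mul hM (Nat.mul_le_mul hM hsn)
  rw [← pow_add, ← pow_add] at h
  have h₁ : X + (X + (s + k)) + 2 = X + (X + (s + k + 1)) + 1 := by ring
  have h₂ : 1 ≤ 2 ^ (X + (X + (s + k + 1))) := Nat.one_le_two_pow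
  calc _ ≤ 2 ^ (X + (X + (s + k + 1)) + 1) := by
        rw [pow_succ]
        omega
    _ = 2 ^ (X + (X + (s + k)) + 2) := by rw [h₁]

/-- Vacuous: `n` points induce no `k`-tuple. -/
theorem mem_semialgRamseySet_of_lt {k d t s n : ℕ} (h : n < k) : n ∈ semialgRamseySet k d t s n :=
  fun _ _ _ => .inr ⟨Finset.univ, by simp, fun i _ => absurd (Fintype.card_le_of_embedding
    i.toEmbedding) (by simpa using h)⟩

end Numerics

theorem theorem1p6 (s t : ℕ) (hs : 4 ≤ s) :
    ∃ c : ℝ, 0 < c ∧ ∀ n : ℕ, 1 ≤ n →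
      (semialgRamseySet 3 1 t s n).Nonempty ∧
        (semialgRamsey 3 1 t s n : ℝ) ≤ 2 ^ ((Real.logb 2 (n : ℝ)) ^ c) := by
  obtain ⟨c, hc⟩ := exists_ramsey_bound s t
  -- The factor `3` comes from `k ≤ L ^ 3`, and the `+ 1` keeps the exponent positive.
  refine ⟨((3 * c + 1 : ℕ) : ℝ), by positivity, fun n hn => ?_⟩
  have reduce : ∀ N ∈ semialgRamseySet 3 1 t s n,
      (N : ℝ) ≤ 2 ^ ((Real.logb 2 (n : ℝ)) ^ ((3 * c + 1 : ℕ) : ℝ)) →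
      (semialgRamseySet 3 1 t s n).Nonempty ∧
        (semialgRamsey 3 1 t s n : ℝ) ≤
          2 ^ ((Real.logb 2 (n : ℝ)) ^ ((3 * c + 1 : ℕ) : ℝ)) :=
    fun N hN hle => ⟨⟨N, hN⟩, le_trans (by exact_mod_cast Nat.sInf_le hN) hle⟩
  -- For `n = 1` and `n = 2` the bound equals `n`, which leaves no slack, but `n` points trivially
  -- suffice.
  rcases lt_or_ge n 3 with h3 | h3
  · refine reduce n (mem_semialgRamseySet_of_lt h3) ?_
    rw [Real.rpow_natCast]
    interval_cases n <;> simp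
  set L := Real.logb 2 (n : ℝ) with hL
  have hn0 : (0 : ℝ) < n := by positivity
  have hL32 : 3 / 2 ≤ L := by
    have h₁ : (3 : ℝ) ≤ Real.logb 2 ((n : ℝ) ^ 2) := by
      rw [Real.le_logb_iff_rpow_le (by norm_num) (by positivity)]
      have : (3 : ℝ) ≤ n := by exact_mod_cast h3
      norm_num
      nlinarith
    rw [Real.logb_pow] at h₁
    push_cast at h₁
    linarith
  set k := Nat.clog 2 n with hk
  have hnk : n ≤ 2 ^ k := Nat.le_pow_clog (by norm_num) n
  have hk2 : 2 ≤ k := by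
    by_contra! h
    have : 2 ^ k ≤ 2 ^ 1 := Nat.pow_le_pow_right (by norm_num) (by omega)
    omega
  -- Rounding up gives `k ≤ L + 1`, which is at most `L ^ 3` because `L ≥ 3 / 2`.
  have hkL : (k : ℝ) ≤ L ^ 3 := by
    have h₁ : 2 ^ (k - 1) < n := Nat.pow_pred_clog_lt_self (by norm_num) (by omega)
    have h₂ : ((k - 1 : ℕ) : ℝ) ≤ L := by
      rw [hL, Real.le_logb_iff_rpow_le (by norm_num) hn0, Real.rpow_natCast]
      exact_mod_cast h₁.le
    rw [Nat.cast_sub (by omega)] at h₂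
    push_cast at h₂
    nlinarith [sq_nonneg L, mul_nonneg (sub_nonneg.2 hL32) (sq_nonneg L)]
  obtain ⟨N, hN, hle⟩ := hc k n hk2 hnk
  refine reduce N hN ?_
  calc (N : ℝ) ≤ (2 : ℝ) ^ ((k : ℝ) ^ c) := by
        rw [← Nat.cast_pow, Real.rpow_natCast]
        exact_mod_cast hle
    _ ≤ 2 ^ (L ^ ((3 * c + 1 : ℕ) : ℝ)) := by
        refine Real.rpow_le_rpow_of_exponent_le (by norm_num) ?_
        rw [Real.rpow_natCast]
        calc (k : ℝ) ^ c ≤ (L ^ 3) ^ c := pow_le_pow_left₀ (Nat.cast_nonneg k) hkL c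
          _ = L ^ (3 * c) := (pow_mul L 3 c).symm
          _ ≤ L ^ (3 * c + 1) := pow_le_pow_right₀ (by linarith) (Nat.le_succ _)
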